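/- **Continuous representer theorem.** Let $\mathcal X\neq\varnothing$ be a set, $\varnothing\neq\mathcal Y\subset\mathbb R$, and let $P$ be a probability measure on a $\sigma$-algebra $\mathfrak A$ on $\mathcal X\times\mathcal Y$. Let $\mathcal F$ be a real separable reflexive Banach space which is strictly convex and smooth, where smooth means that for every $w\in\mathcal F$ with $\|w\|=1$ there is exactly one $w^*\in\mathcal F^*$ with $\|w^*\|=1$ and $\langle w,w^*\rangle=1$. Let $\Phi\colon\mathcal X\to\mathcal F^*$ be such that $(x,y)\mapsto\Phi(x)$ is $\mathfrak A$-measurable, and suppose that $(x,y)\mapsto y$ is $\mathfrak A$-measurable. Let $L\colon\mathbb R\to[0,+\infty[$ be convex, $p\in[1,+\infty[$ with conjugate exponent $p^*\in\,]1,+\infty]$, i.e. $1/p+1/p^*=1$, and $\gamma>0$. Suppose that there are $a,b_0\ge 0$ with $L(t)\le a+b_0|t|^p$ for all $t\in\mathbb R$, and that $$\int_{\mathcal X\times\mathcal Y}|y|^p\,dP(x,y)<+\infty,\qquad \int_{\mathcal X\times\mathcal Y}\|\Phi(x)\|^p\,dP(x,y)<+\infty .$$ Let $\varphi\colon\mathbb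 R\to[0,+\infty[$ be convex and even with $\operatorname{argmin}\varphi=\{0\}$, and let $G=\varphi\circ\|\cdot\|\colon\mathcal F\to\mathbb R$. Let $(w,b,e)$ be a solution of the problem $$(\mathcal P)\qquad \min_{(w,b,e)\in\mathcal F\times\mathbb R\times L^p(P)}\ \gamma\int_{\mathcal X\times\mathcal Y}L(e(x,y))\,dP(x,y)+G(w)\quad\text{subject to } y-\langle w,\Phi(x)\rangle-b=e(x,y)\ \text{ for } P\text{-a.a. }(x,y).$$ For $r\in\,]1,+\infty[$ let $J_r\colon\mathcal F\to\mathcal F^*$ be the $r$-duality map of $\mathcal F$, that is, the unique map with $\langle v,J_r(v)\rangle=\|v\|^r$ and $\|J_r(v)\|=\|v\|^{r-1}$ for all $v\in\mathcal F$. Then: (i) for every $r\in\,]1,+\infty[$ there is a function $c\in L^{p^*}(P)$ such that $(x,y)\mapsto c(x,y)\Phi(x)$ is Bochner integrable and $$J_r(w)=\int_{\mathcal X\times\mathcal Y}c(x,y)\,\Phi(x)\,dP(x,y);$$ (ii) if $P=\frac1n\sum_{i=1}^n\delta_{(x_i,y_i)}$ for some sample $(x_i,y_i)_{1\le i\le n}\in(\mathcal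 X\times\mathcal Y)^n$, then there is $(c_i)_{1\le i\le n}\in\mathbb R^n$ with $J_2(w)=\sum_{i=1}^n c_i\Phi(x_i)$. -/

import Mathlib

open MeasureTheory
open scoped ENNReal

namespace SVR

section BanachGeometry

variable {F : Type*} [NormedAddCommGroup F] [NormedSpace ℝ F]

/-- Reflexivity: the canonical embedding into the bidual is onto. -/
def IsReflexiveSpace (F : Type*) [NormedAddCommGroup F] [NormedSpace ℝ F] : Prop :=
  Function.Surjective (NormedSpace.inclusionInDoubleDual ℝ F)

/-- Smoothness: every point of the unit sphere has exactly one norming functional. -/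
def IsSmoothSpace (F : Type*) [NormedAddCommGroup F] [NormedSpace ℝ F] : Prop :=
  ∀ w : F, ‖w‖ = 1 → ∃! f : StrongDual ℝ F, ‖f‖ = 1 ∧ f w = 1

/-- The `r`-duality map `J_r : F → F*`: the norming functional of `w`, times `‖w‖ ^ (r - 1)`.
For `r > 1` it has the defining properties of the duality map (`dualityMap_spec`), and in a smooth
space it is the only map which has them (`eq_dualityMap`). -/
noncomputable def dualityMap (r : ℝ) (w : F) : StrongDual ℝ F :=
  ‖w‖ ^ (r - 1) • (exists_dual_vector'' ℝ w).choose

theorem dualityMap_spec {r : ℝ} (hr : 1 < r) (w : F) :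
    dualityMap r w w = ‖w‖ ^ r ∧ ‖dualityMap r w‖ = ‖w‖ ^ (r - 1) := by
  have hr1 : r - 1 ≠ 0 := by linarith
  obtain ⟨h1, h2⟩ := (exists_dual_vector'' ℝ w).choose_spec
  have h2' : (exists_dual_vector'' ℝ w).choose w = ‖w‖ := by simpa using h2
  by_cases hw : w = 0
  · subst hw
    have : r ≠ 0 := by linarith
    simp [dualityMap, Real.zero_rpow hr1, Real.zero_rpow this]
  · have hpos : 0 < ‖w‖ := norm_pos_iff.mpr hw
    constructor
    · have : ‖w‖ ^ r = ‖w‖ ^ (r - 1) * ‖w‖ := by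
        rw [← Real.rpow_add_one hpos.ne']; ring_nf
      simp only [dualityMap, ContinuousLinearMap.smul_apply, smul_eq_mul, h2', this]
    · have hn : ‖(exists_dual_vector'' ℝ w).choose‖ = 1 := by
        refine le_antisymm h1 ?_
        have h3 := (exists_dual_vector'' ℝ w).choose.le_opNorm w
        rw [h2', norm_norm] at h3
        by_contra hlt
        push Not at hlt
        nlinarith
      rw [dualityMap, norm_smul, hn, mul_one, Real.norm_of_nonneg (by positivity)]

theorem eq_dualityMap (hF : IsSmoothSpace F) {r : ℝ} (hr : 1 < r) {w : F} {f : StrongDual ℝ F}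
    (h1 : f w = ‖w‖ ^ r) (h2 : ‖f‖ = ‖w‖ ^ (r - 1)) : f = dualityMap r w := by
  obtain ⟨k1, k2⟩ := dualityMap_spec hr w
  by_cases hw : w = 0
  · subst hw
    have hr1 : r - 1 ≠ 0 := by linarith
    rw [norm_zero, Real.zero_rpow hr1, norm_eq_zero] at h2 k2
    rw [h2, k2]
  · have hpos : 0 < ‖w‖ := norm_pos_iff.mpr hw
    have hq : 0 < ‖w‖ ^ (r - 1) := by positivity
    have hrr : ‖w‖ ^ r = ‖w‖ ^ (r - 1) * ‖w‖ := by
      rw [← Real.rpow_add_one hpos.ne']; ring_nf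
    have key : ∀ g : StrongDual ℝ F, g w = ‖w‖ ^ r → ‖g‖ = ‖w‖ ^ (r - 1) →
        ‖(‖w‖ ^ (r - 1))⁻¹ • g‖ = 1 ∧ ((‖w‖ ^ (r - 1))⁻¹ • g) (‖w‖⁻¹ • w) = 1 := by
      intro g g1 g2
      constructor
      · rw [norm_smul, g2, Real.norm_of_nonneg (by positivity), inv_mul_cancel₀ hq.ne']
      · simp only [ContinuousLinearMap.smul_apply, map_smul, smul_eq_mul, g1, hrr]
        field_simp
    have hu : ‖‖w‖⁻¹ • w‖ = 1 := by
      rw [norm_smul, norm_inv, norm_norm, inv_mul_cancel₀ hpos.ne']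
    have := (hF _ hu).unique (key f h1 h2) (key _ k1 k2)
    exact smul_right_injective _ (inv_ne_zero hq.ne') this

end BanachGeometry

section Problem

variable {X : Type*} {Y : Set ℝ} [MeasurableSpace (X × Y)]
  {F : Type*} [NormedAddCommGroup F] [NormedSpace ℝ F]

/-- The objective function `γ ∫ L(e(x,y)) dP(x,y) + G(w)`. -/
noncomputable def objective (P : Measure (X × Y)) (L : ℝ → ℝ) (γ : ℝ) (G : F → ℝ)
    (w : F) (e : X × Y → ℝ) : ℝ :=
  γ * ∫ z, L (e z) ∂P + G w

/-- The constraints: `e ∈ L^p(P)` and `y - ⟨w, Φ(x)⟩ - b = e(x,y)` for `P`-almost all `(x,y)`. -/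
def IsFeasible (P : Measure (X × Y)) (Φ : X → StrongDual ℝ F) (p : ℝ)
    (w : F) (b : ℝ) (e : X × Y → ℝ) : Prop :=
  MemLp e (ENNReal.ofReal p) P ∧ ∀ᵐ z ∂P, (z.2 : ℝ) - Φ z.1 w - b = e z

/-- `(w, b, e)` solves the primal problem: it minimizes the objective over all feasible triples. -/
def IsSolution (P : Measure (X × Y)) (Φ : X → StrongDual ℝ F) (L : ℝ → ℝ) (p γ : ℝ) (G : F → ℝ)
    (w : F) (b : ℝ) (e : X × Y → ℝ) : Prop :=
  IsFeasible P Φ p w b e ∧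
    ∀ (w' : F) (b' : ℝ) (e' : X × Y → ℝ), IsFeasible P Φ p w' b' e' →
      objective P L γ G w e ≤ objective P L γ G w' e'

end Problem

end SVR

/-! Let the residual and the weight vary independently: `q (u, v)` is the change of the objective
when `e` becomes `e + u` and `w` becomes `w + v`. It is convex, and optimality says that it is
nonnegative on the subspace of perturbations compatible with the constraint. A Hahn–Banach argument
(`exists_linearMap_le_of_nonneg_on_submodule`) gives a linear `l ≤ q` vanishing on that subspace.

On the residual part, `l` lies below an integral functional of growth `p`, hence is integration
against some `c` in the dual exponent (`exists_memLp_of_le_integral_loss`). Vanishing on the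
subspace turns this into `∫ c Φ` being a subgradient at `w` of `φ ∘ ‖·‖`. In a smooth space such a
subgradient determines the direction of the duality map (`exists_dualityMap_eq_smul`), so rescaling
`c` proves (i). For an empirical measure the integral is a finite sum, which is (ii). -/

namespace SVR

/-! ### Separability of the dual -/

/-- A real normed space with separable dual is separable. -/
theorem separableSpace_of_separableSpace_strongDual (E : Type*) [NormedAddCommGroup E]
    [NormedSpace ℝ E] [TopologicalSpace.SeparableSpace (StrongDual ℝ E)] :
    TopologicalSpace.SeparableSpace E := by
  set f := TopologicalSpace.denseSeq (StrongDual ℝ E) with hf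
  have hx : ∀ n, ∃ x : E, ‖x‖ ≤ 1 ∧ ‖f n‖ / 2 ≤ |f n x| := by
    intro n
    by_cases h : ‖f n‖ = 0
    · exact ⟨0, by simp, by simp [h]⟩
    · have hpos : 0 < ‖f n‖ := lt_of_le_of_ne (norm_nonneg _) (Ne.symm h)
      obtain ⟨x, hx1, hx2⟩ := (f n).exists_lt_apply_of_lt_opNorm (half_lt_self hpos)
      exact ⟨x, hx1.le, hx2.le⟩
  choose x hx1 hx2 using hx
  have hsep : TopologicalSpace.IsSeparable
      (closure (Submodule.span ℝ (Set.range x) : Set E)) :=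
    ((Set.countable_range x).isSeparable.span).closure
  suffices h : closure (Submodule.span ℝ (Set.range x) : Set E) = Set.univ by
    rw [h] at hsep
    exact TopologicalSpace.isSeparable_univ_iff.mp hsep
  -- Otherwise some `g ≠ 0` kills every `x n`. For `f n` within `‖g‖ / 4` of `g`, `‖f n‖ / 2 ≤ |(f n
  -- - g) (x n)| < ‖g‖ / 4`, whence `‖g‖ < 3 ‖g‖ / 4`.
  by_contra hne
  obtain ⟨a, ha⟩ := (Set.ne_univ_iff_exists_notMem _).mp hne
  obtain ⟨g, u, hg, hu⟩ := geometric_hahn_banach_closed_point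
    ((Submodule.span ℝ (Set.range x)).convex.closure) isClosed_closure ha
  have hu0 : 0 < u := by simpa using hg 0 (subset_closure (Submodule.zero_mem _))
  have hgx : ∀ n, g (x n) = 0 := by
    intro n
    by_contra h
    have := hg ((u / g (x n)) • x n) (subset_closure
      (Submodule.smul_mem _ _ (Submodule.subset_span ⟨n, rfl⟩)))
    rw [map_smul, smul_eq_mul, div_mul_cancel₀ _ h] at this
    exact lt_irrefl _ this
  have hg0 : 0 < ‖g‖ := by
    rw [norm_pos_iff]
    rintro rfl
    simp only [zero_apply] at hu
    linarith
  obtain ⟨n, hn⟩ := (TopologicalSpace.denseRange_denseSeq (StrongDual ℝ E)).exists_dist_lt g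
    (show (0 : ℝ) < ‖g‖ / 4 by positivity)
  rw [← hf, dist_eq_norm] at hn
  have h1 : |f n (x n)| ≤ ‖g - f n‖ := by
    have := (g - f n).le_opNorm_of_le (hx1 n)
    simpa [hgx n] using this
  have h2 : ‖g‖ ≤ ‖g - f n‖ + ‖f n‖ := by simpa using norm_add_le (g - f n) (f n)
  linarith [hx2 n]

/-- This makes the measurable feature map strongly measurable, as Bochner integration requires. -/
theorem IsReflexiveSpace.separableSpace_strongDual {F : Type*} [NormedAddCommGroup F]
    [NormedSpace ℝ F] [TopologicalSpace.SeparableSpace F] (hF : IsReflexiveSpace F) :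
    TopologicalSpace.SeparableSpace (StrongDual ℝ F) := by
  have : TopologicalSpace.SeparableSpace (StrongDual ℝ (StrongDual ℝ F)) :=
    hF.denseRange.separableSpace (NormedSpace.inclusionInDoubleDual ℝ F).continuous
  exact separableSpace_of_separableSpace_strongDual _

/-! ### Hahn–Banach for convex functions -/

/-- A convex function which is nonnegative on a subspace majorizes a linear functional which
vanishes on that subspace. -/
theorem exists_linearMap_le_of_nonneg_on_submodule {E : Type*} [AddCommGroup E] [Module ℝ E]
    {q : E → ℝ} (hq : ConvexOn ℝ Set.univ q) (S : Submodule ℝ E) (hS : ∀ x ∈ S, 0 ≤ q x) :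
    ∃ l : E →ₗ[ℝ] ℝ, (∀ x, l x ≤ q x) ∧ ∀ x ∈ S, l x = 0 := by
  -- The cone generated by the epigraph of `q`. The functional `(x, t) ↦ t` on `S × ℝ` is
  -- nonnegative on it, and its positive extension `g` yields `l x = -g (x, 0)`.
  let C : PointedCone ℝ (E × ℝ) :=
    { carrier := {y | y = 0 ∨ ∃ s : ℝ, 0 < s ∧ q (s • y.1) ≤ s * y.2}
      zero_mem' := Or.inl rfl
      add_mem' := by
        rintro y z (rfl | ⟨s, hs, hy⟩) (rfl | ⟨t, ht, hz⟩)
        · exact Or.inl (add_zero _)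
        · exact Or.inr ⟨t, ht, by simpa using hz⟩
        · exact Or.inr ⟨s, hs, by simpa using hy⟩
        -- The convex combination of `s • y` and `t • z` with weights proportional to `t` and `s` is
        -- a multiple of `y + z`.
        · refine Or.inr ⟨s * t / (s + t), by positivity, ?_⟩
          have h := hq.2 (Set.mem_univ (s • y.1)) (Set.mem_univ (t • z.1))
            (show 0 ≤ t / (s + t) by positivity) (show 0 ≤ s / (s + t) by positivity)
            (by field_simp; ring)
          have e1 : (s * t / (s + t)) • (y + z).1 =
              (t / (s + t)) • s • y.1 + (s / (s + t)) • t • z.1 := by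
            rw [Prod.fst_add, smul_add, smul_smul, smul_smul]
            congr 2 <;> ring
          rw [e1]
          refine h.trans ?_
          simp only [smul_eq_mul, Prod.snd_add]
          calc _ ≤ t / (s + t) * (s * y.2) + s / (s + t) * (t * z.2) := by gcongr
            _ = _ := by ring
      smul_mem' := by
        rintro ⟨c, hc⟩ y (rfl | ⟨s, hs, hy⟩)
        · exact Or.inl (smul_zero _)
        · rcases hc.eq_or_lt with rfl | hc
          · exact Or.inl (by ext <;> simp)
          · refine Or.inr ⟨s / c, by positivity, ?_⟩
            change q ((s / c) • c • y.1) ≤ s / c * (c * y.2)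
            rw [smul_smul, div_mul_cancel₀ _ hc.ne', ← mul_assoc, div_mul_cancel₀ _ hc.ne']
            exact hy }
  have hC : ∀ y : E × ℝ, q y.1 ≤ y.2 → y ∈ C := fun y hy => Or.inr ⟨1, one_pos, by simpa using hy⟩
  obtain ⟨g, hg, hgC⟩ := riesz_extension C
    ⟨S.prod ⊤, (LinearMap.snd ℝ E ℝ).comp (S.prod ⊤).subtype⟩
    (by
      rintro ⟨⟨x, t⟩, hx⟩ (h | ⟨s, hs, h⟩)
      · exact (congrArg Prod.snd h).symm.le
      · have h0 := (hS _ (S.smul_mem s hx.1)).trans h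
        exact nonneg_of_mul_nonneg_right h0 hs)
    (by
      rintro ⟨x, t⟩
      exact ⟨⟨(0, q x - t), S.zero_mem, trivial⟩, hC _ (by simp)⟩)
  have hval : ∀ x ∈ S, ∀ t, g (x, t) = t := fun x hx t => hg ⟨(x, t), hx, trivial⟩
  refine ⟨-(g.comp (LinearMap.inl ℝ E ℝ)), fun x => ?_, fun x hx => ?_⟩
  · have h1 := hgC (x, q x) (hC _ le_rfl)
    have h2 : g (x, q x) = g (x, 0) + g (0, q x) := by rw [← map_add]; simp
    rw [hval 0 S.zero_mem] at h2
    simp only [LinearMap.neg_apply, LinearMap.comp_apply, LinearMap.inl_apply]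
    linarith
  · simp [hval x hx]

/-! ### Even convex functions of the norm and the duality map -/

section Even

variable {φ : ℝ → ℝ}

theorem convexOn_even_le (hφ : ConvexOn ℝ Set.univ φ) (he : ∀ t, φ (-t) = φ t) {s t : ℝ}
    (hs : 0 ≤ s) (hst : s ≤ t) : φ s ≤ φ t := by
  have h := hφ.le_max_of_mem_Icc (Set.mem_univ (-t)) (Set.mem_univ t)
    (show s ∈ Set.Icc (-t) t from ⟨by linarith, hst⟩)
  rwa [he, max_self] at h

theorem lt_of_argmin_eq (ha : {t : ℝ | ∀ s, φ t ≤ φ s} = {0}) {t : ℝ} (ht : t ≠ 0) :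
    φ 0 < φ t := by
  have h0 : (0 : ℝ) ∈ {t : ℝ | ∀ s, φ t ≤ φ s} := by rw [ha]; rfl
  refine lt_of_le_of_ne (h0 t) fun h => ht ?_
  have : t ∈ {t : ℝ | ∀ s, φ t ≤ φ s} := fun s => h ▸ h0 s
  rwa [ha] at this

theorem convexOn_even_comp_norm {F : Type*} [NormedAddCommGroup F] [NormedSpace ℝ F]
    (hφ : ConvexOn ℝ Set.univ φ) (he : ∀ t, φ (-t) = φ t) :
    ConvexOn ℝ Set.univ fun v : F => φ ‖v‖ := by
  refine ⟨convex_univ, fun x _ y _ a b ha hb hab => ?_⟩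
  refine (convexOn_even_le hφ he (norm_nonneg _) ?_).trans
    (hφ.2 (Set.mem_univ ‖x‖) (Set.mem_univ ‖y‖) ha hb hab)
  refine (norm_add_le _ _).trans ?_
  simp [norm_smul, abs_of_nonneg ha, abs_of_nonneg hb]

/-- The `r`-duality map of a smooth space at `w` is a multiple of every subgradient at `w` of
`φ ∘ ‖·‖`. -/
theorem exists_dualityMap_eq_smul {F : Type*} [NormedAddCommGroup F] [NormedSpace ℝ F]
    (hF : IsSmoothSpace F) (hφ : ConvexOn ℝ Set.univ φ) (he : ∀ t, φ (-t) = φ t)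
    (ha : {t : ℝ | ∀ s, φ t ≤ φ s} = {0}) {w : F} {M : StrongDual ℝ F}
    (hM : ∀ v, M v ≤ φ ‖w + v‖ - φ ‖w‖) {r : ℝ} (hr : 1 < r) :
    ∃ k : ℝ, dualityMap r w = k • M := by
  by_cases hw : w = 0
  · refine ⟨0, ?_⟩
    have := (dualityMap_spec hr w).2
    rw [hw, norm_zero, Real.zero_rpow (by linarith), norm_eq_zero] at this
    rw [hw, this, zero_smul]
  have hpos : 0 < ‖w‖ := norm_pos_iff.mpr hw
  have hMw : 0 < M w := by
    have h1 := hM (-w)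
    have h2 := lt_of_argmin_eq ha hpos.ne'
    rw [map_neg, add_neg_cancel, norm_zero] at h1
    linarith
  -- `M` attains its maximum over the ball of radius `‖w‖` at `w`, so it is a positive multiple of a
  -- norming functional of `w`.
  have hball : ∀ x, ‖x‖ ≤ ‖w‖ → M x ≤ M w := by
    intro x hx
    have h1 := hM (x - w)
    have h2 := convexOn_even_le hφ he (norm_nonneg _) hx
    rw [map_sub, add_sub_cancel] at h1
    linarith
  have hnorm : ‖M‖ = M w / ‖w‖ := by
    refine le_antisymm (ContinuousLinearMap.opNorm_le_of_unit_norm (by positivity) ?_) ?_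
    · intro x hx
      rw [le_div_iff₀ hpos, Real.norm_eq_abs, ← abs_of_pos hpos, ← abs_mul, mul_comm,
        ← smul_eq_mul, ← map_smul, abs_le]
      have hn : ‖‖w‖ • x‖ ≤ ‖w‖ := by simp [norm_smul, hx]
      have h1 := hball (-(‖w‖ • x)) (by rwa [norm_neg])
      rw [map_neg] at h1
      exact ⟨by linarith, hball _ hn⟩
    · rw [div_le_iff₀ hpos]
      exact (le_abs_self _).trans (M.le_opNorm w)
  have hrr : ‖w‖ ^ r = ‖w‖ ^ (r - 1) * ‖w‖ := by
    rw [← Real.rpow_add_one hpos.ne']; ring_nf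
  refine ⟨‖w‖ ^ r / M w, (eq_dualityMap hF hr ?_ ?_).symm⟩
  · simp only [smul_apply, smul_eq_mul]
    exact div_mul_cancel₀ _ hMw.ne'
  · rw [norm_smul, hnorm, Real.norm_of_nonneg (by positivity), hrr]
    field_simp

end Even

end SVR

namespace SVR

/-! ### Functionals on `L^q` of a finite measure -/

section LpDual

variable {Ω : Type*} [MeasurableSpace Ω] {μ : Measure Ω} [IsFiniteMeasure μ]

open Filter Topology in
theorem hasSum_indicatorConstLp {q : ℝ≥0∞} [Fact (1 ≤ q)] (hq : q ≠ ∞) {f : ℕ → Set Ω}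
    (hf : ∀ i, MeasurableSet (f i)) (hd : Pairwise (Function.onFun Disjoint f)) :
    HasSum (fun i => indicatorConstLp q (hf i) (measure_ne_top μ _) (1 : ℝ))
      (indicatorConstLp q (MeasurableSet.iUnion hf) (measure_ne_top μ _) (1 : ℝ)) := by
  have hsum : ∀ t : Finset ℕ, ∑ i ∈ t, indicatorConstLp q (hf i) (measure_ne_top μ _) (1 : ℝ) =
      indicatorConstLp q (t.measurableSet_biUnion fun i _ => hf i) (measure_ne_top μ _) (1 : ℝ) := by
    intro t
    induction t using Finset.induction_on with
    | empty => simp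
    | insert a t ha ih =>
      rw [Finset.sum_insert ha, ih, ← indicatorConstLp_disjoint_union]
      · simp only [Finset.set_biUnion_insert]
      · rw [Set.disjoint_iUnion₂_right]
        exact fun i hi => hd fun h => ha (h ▸ hi)
  rw [HasSum]
  simp only [hsum]
  refine tendsto_indicatorConstLp_set hq ?_
  have h1 : Tendsto (fun t : Finset ℕ => μ (⋃ i, f i) - ∑ i ∈ t, μ (f i)) atTop (𝓝 0) := by
    have h2 : HasSum (fun i => μ (f i)) (μ (⋃ i, f i)) := by
      rw [measure_iUnion hd hf]
      exact ENNReal.summable.hasSum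
    have h3 := ENNReal.Tendsto.sub (tendsto_const_nhds (x := μ (⋃ i, f i))) h2
      (Or.inl (measure_ne_top μ _))
    rwa [tsub_self] at h3
  refine h1.congr fun t => ?_
  have hsub : ⋃ i ∈ t, f i ⊆ ⋃ i, f i := Set.iUnion₂_subset fun i _ => Set.subset_iUnion f i
  rw [symmDiff_of_le hsub, measure_sdiff hsub
    (t.measurableSet_biUnion fun i _ => hf i).nullMeasurableSet (measure_ne_top μ _),
    measure_biUnion_finset (fun i _ j _ hij => hd hij) fun i _ => hf i]

open Classical in
/-- A continuous linear functional on `L^q` of a finite measure has a density on indicators. -/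
theorem exists_density_of_strongDual_Lp {q : ℝ≥0∞} [Fact (1 ≤ q)] (hq : q ≠ ∞)
    (l : StrongDual ℝ (Lp ℝ q μ)) :
    ∃ c : Ω → ℝ, Measurable c ∧ Integrable c μ ∧ ∀ s (hs : MeasurableSet s),
      l (indicatorConstLp q hs (measure_ne_top μ s) (1 : ℝ)) = ∫ x in s, c x ∂μ := by
  -- The values of `l` on indicators form a signed measure absolutely continuous with respect to
  -- `μ`; its Radon–Nikodym derivative is the density.
  let ν : SignedMeasure Ω :=
    { measureOf' := fun s => if hs : MeasurableSet s then
        l (indicatorConstLp q hs (measure_ne_top μ s) (1 : ℝ)) else 0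
      empty' := by simp
      not_measurable' := fun s hs => dif_neg hs
      m_iUnion' := fun f hf hd => by
        simp only [hf, MeasurableSet.iUnion hf, dif_pos]
        exact l.hasSum (hasSum_indicatorConstLp hq hf hd) }
  have hν : ∀ s (hs : MeasurableSet s),
      ν s = l (indicatorConstLp q hs (measure_ne_top μ s) (1 : ℝ)) := fun s hs => dif_pos hs
  have hac : VectorMeasure.AbsolutelyContinuous ν μ.toENNRealVectorMeasure := by
    refine VectorMeasure.AbsolutelyContinuous.mk fun s hs h0 => ?_
    rw [Measure.toENNRealVectorMeasure_apply_measurable hs] at h0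
    rw [hν s hs]
    have : indicatorConstLp q hs (measure_ne_top μ s) (1 : ℝ) = 0 := by
      rw [← indicatorConstLp_empty (p := q) (μ := μ) (c := (1 : ℝ)),
        indicatorConstLp_inj _ _ _ _ one_ne_zero]
      exact ae_eq_empty.mpr h0
    rw [this, map_zero]
  refine ⟨ν.rnDeriv μ, SignedMeasure.measurable_rnDeriv _ _,
    SignedMeasure.integrable_rnDeriv _ _, fun s hs => ?_⟩
  rw [← hν s hs, ← withDensityᵥ_apply (SignedMeasure.integrable_rnDeriv _ _) hs,
    SignedMeasure.withDensityᵥ_rnDeriv_eq _ _ hac]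

/-- By Hölder, both sides are continuous in `f`; they agree on indicators, whose span is dense
because `q ≠ ∞`. -/
theorem strongDual_Lp_eq_integral {q q' : ℝ≥0∞} [Fact (1 ≤ q)] [Fact (1 ≤ q')]
    [ENNReal.HolderConjugate q' q] (hq : q ≠ ∞)
    (l : StrongDual ℝ (Lp ℝ q μ)) {c : Ω → ℝ} (hc : MemLp c q' μ)
    (hl : ∀ s (hs : MeasurableSet s),
      l (indicatorConstLp q hs (measure_ne_top μ s) (1 : ℝ)) = ∫ x in s, c x ∂μ)
    (f : Lp ℝ q μ) : l f = ∫ x, c x * f x ∂μ := by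
  let m : StrongDual ℝ (Lp ℝ q μ) :=
    ContinuousLinearMap.lpPairing μ q' q (ContinuousLinearMap.mul ℝ ℝ) (hc.toLp c)
  have hm : ∀ f : Lp ℝ q μ, m f = ∫ x, c x * f x ∂μ := by
    intro f
    rw [ContinuousLinearMap.lpPairing_eq_integral]
    refine integral_congr_ae ?_
    filter_upwards [hc.coeFn_toLp] with x hx
    simp [hx]
  rw [← hm]
  refine Lp.induction hq (fun f => l f = m f) ?_ ?_ ?_ f
  · intro a s hs hμs
    have h1 : (Lp.simpleFunc.indicatorConst q hs hμs.ne a : Lp ℝ q μ) =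
        a • indicatorConstLp q hs (measure_ne_top μ s) (1 : ℝ) := by
      rw [Lp.simpleFunc.coe_indicatorConst, indicatorConstLp, indicatorConstLp, ← MemLp.toLp_const_smul]
      congr 1
      ext x
      by_cases h : x ∈ s <;> simp [h]
    rw [h1, map_smul, map_smul, hl s hs, hm, ← integral_indicator hs]
    congr 1
    refine integral_congr_ae ?_
    filter_upwards [indicatorConstLp_coeFn (p := q) (hs := hs) (hμs := measure_ne_top μ s)
      (c := (1 : ℝ))] with x hx
    rw [hx]
    by_cases h : x ∈ s <;> simp [h]
  · intro f g hf hg _ h1 h2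
    rw [map_add, map_add, h1, h2]
  · exact isClosed_eq l.continuous m.continuous

end LpDual

/-! ### Integral functionals of a convex loss -/

section Loss

variable {Ω : Type*} [MeasurableSpace Ω] {μ : Measure Ω} {L : ℝ → ℝ} {p a b : ℝ}

theorem continuous_of_convexOn_univ (hL : ConvexOn ℝ Set.univ L) : Continuous L := by
  rw [← continuousOn_univ]
  exact hL.continuousOn isOpen_univ

theorem integrable_abs_rpow (hp : 1 ≤ p) {u : Ω → ℝ} (hu : MemLp u (ENNReal.ofReal p) μ) :
    Integrable (fun z => |u z| ^ p) μ := by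
  have h := hu.integrable_norm_rpow (by simp; linarith) ENNReal.ofReal_ne_top
  rwa [ENNReal.toReal_ofReal (by linarith)] at h

variable [IsProbabilityMeasure μ]

theorem integrable_loss (hL0 : ∀ t, 0 ≤ L t) (hL : ConvexOn ℝ Set.univ L) (hp : 1 ≤ p)
    (hLg : ∀ t, L t ≤ a + b * |t| ^ p) {u : Ω → ℝ} (hu : MemLp u (ENNReal.ofReal p) μ) :
    Integrable (fun z => L (u z)) μ := by
  refine Integrable.mono' ((integrable_const a).add ((integrable_abs_rpow hp hu).const_mul b))
    ((continuous_of_convexOn_univ hL).comp_aestronglyMeasurable hu.1) ?_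
  filter_upwards with z
  rw [Real.norm_of_nonneg (hL0 _)]
  exact hLg _

/-- A function lying below the difference quotients of a loss of growth `p` has growth `p - 1`. -/
theorem memLp_of_mul_le_loss (hp : 1 ≤ p) (hb : 0 ≤ b) (ha : 0 ≤ a) {γ : ℝ} (hγ : 0 < γ)
    (hL0 : ∀ t, 0 ≤ L t)
    (hLg : ∀ t, L t ≤ a + b * |t| ^ p) {e c : Ω → ℝ} (he : MemLp e (ENNReal.ofReal p) μ)
    (hc : Measurable c) (h : ∀ t : ℤ, ∀ᵐ z ∂μ, c z * t ≤ γ * (L (e z + t) - L (e z))) :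
    MemLp c (ENNReal.conjExponent (ENNReal.ofReal p)) μ := by
  have he2 : MemLp (fun z => |e z| + 2) (ENNReal.ofReal p) μ := he.abs.add (memLp_const 2)
  -- This includes `p = 1`, where `1 / 0 = ∞` is the correct conjugate exponent.
  have hexp : ENNReal.ofReal p / ENNReal.ofReal (p - 1) =
      ENNReal.conjExponent (ENNReal.ofReal p) := by
    rw [ENNReal.conjExponent, ENNReal.ofReal_sub _ zero_le_one, ENNReal.ofReal_one]
    have h1 : (1 : ℝ≥0∞) ≤ ENNReal.ofReal p := by simpa using hp
    rcases h1.eq_or_lt with h1 | h1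
    · simp [← h1]
    · have h2 : ENNReal.ofReal p - 1 ≠ 0 := (tsub_pos_of_lt h1).ne'
      have h3 : ENNReal.ofReal p - 1 ≠ ∞ := ENNReal.sub_ne_top ENNReal.ofReal_ne_top
      nth_rewrite 1 [← tsub_add_cancel_of_le h1.le]
      rw [ENNReal.add_div, ENNReal.div_self h2 h3, one_div]
  have hk := he2.norm_rpow_div (ENNReal.ofReal (p - 1))
  rw [hexp, ENNReal.toReal_ofReal (by linarith)] at hk
  refine (hk.const_mul (γ * (a + b * 2 ^ p))).mono' hc.aestronglyMeasurable ?_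
  -- Integer increments keep the exceptional sets countable in number. Testing with `±n`, where `n`
  -- is comparable to `|e z| + 1`, bounds `|c z|` by a multiple of `n ^ p / n`.
  filter_upwards [ae_all_iff.mpr h] with z hz
  set n : ℕ := ⌈|e z|⌉₊ + 1 with hn
  have hn1 : (1 : ℝ) ≤ n := by rw [hn]; push_cast; linarith [Nat.cast_nonneg (α := ℝ) ⌈|e z|⌉₊]
  have hn2 : |e z| ≤ n := by rw [hn]; push_cast; linarith [Nat.le_ceil |e z|]
  have hn3 : (n : ℝ) ≤ |e z| + 2 := by
    rw [hn]; push_cast; linarith [(Nat.ceil_lt_add_one (abs_nonneg (e z))).le]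
  have hn0 : (0 : ℝ) < n := by linarith
  have hrpow : (n : ℝ) ^ p = (n : ℝ) ^ (p - 1) * n := by
    rw [← Real.rpow_add_one hn0.ne']; ring_nf
  have hone : (1 : ℝ) ≤ (n : ℝ) ^ (p - 1) := Real.one_le_rpow hn1 (by linarith)
  have hbd : ∀ t : ℝ, |t| ≤ n → L (e z + t) - L (e z) ≤ (a + b * 2 ^ p) * (n : ℝ) ^ (p - 1) * n := by
    intro t ht
    have h1 : |e z + t| ≤ 2 * n := (abs_add_le _ _).trans (by linarith)
    calc L (e z + t) - L (e z) ≤ a + b * |e z + t| ^ p := by linarith [hLg (e z + t), hL0 (e z)]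
      _ ≤ a + b * (2 * n) ^ p := by gcongr
      _ = a * 1 + b * 2 ^ p * (n ^ (p - 1) * n) := by
        rw [Real.mul_rpow zero_le_two hn0.le, hrpow]; ring
      _ ≤ a * (n ^ (p - 1) * n) + b * 2 ^ p * (n ^ (p - 1) * n) := by
        gcongr
        nlinarith
      _ = _ := by ring
  have hcn : |c z| * n ≤ γ * ((a + b * 2 ^ p) * (n : ℝ) ^ (p - 1) * n) := by
    have h1 := hz n
    have h2 := hz (-n)
    push_cast at h1 h2
    have h3 := hbd n (by simp)
    have h4 := hbd (-n) (by simp)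
    have h5 := mul_le_mul_of_nonneg_left h3 hγ.le
    have h6 := mul_le_mul_of_nonneg_left h4 hγ.le
    rcases abs_cases (c z) with ⟨h, -⟩ | ⟨h, -⟩ <;> rw [h] <;> linarith
  have hcn' : |c z| ≤ γ * (a + b * 2 ^ p) * (n : ℝ) ^ (p - 1) := by
    refine le_of_mul_le_mul_right ?_ hn0
    calc _ ≤ _ := hcn
      _ = _ := by ring
  refine hcn'.trans ?_
  rw [Real.norm_of_nonneg (show 0 ≤ |e z| + 2 by positivity)]
  gcongr

/-- The integral functional `u ↦ ∫ L (e + u) - ∫ L e` on `L^p`: a linear functional below it is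
integration against a function in the dual exponent. -/
theorem exists_memLp_of_le_integral_loss (hL0 : ∀ t, 0 ≤ L t) (hL : ConvexOn ℝ Set.univ L)
    (hp : 1 ≤ p) [Fact (1 ≤ ENNReal.ofReal p)] (ha : 0 ≤ a) (hb : 0 ≤ b)
    (hLg : ∀ t, L t ≤ a + b * |t| ^ p) {γ : ℝ}
    (hγ : 0 < γ) {e : Ω → ℝ} (he : MemLp e (ENNReal.ofReal p) μ)
    (l : Lp ℝ (ENNReal.ofReal p) μ →ₗ[ℝ] ℝ)
    (hl : ∀ u, l u ≤ γ * ∫ z, L (e z + u z) ∂μ - γ * ∫ z, L (e z) ∂μ) :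
    ∃ c : Ω → ℝ, Measurable c ∧ MemLp c (ENNReal.conjExponent (ENNReal.ofReal p)) μ ∧
      ∀ u, l u = ∫ z, c z * u z ∂μ := by
  have hint : ∀ u : Lp ℝ (ENNReal.ofReal p) μ, Integrable (fun z => L (e z + u z)) μ :=
    fun u => integrable_loss hL0 hL hp hLg (he.add (Lp.memLp u))
  have hint0 : Integrable (fun z => L (e z)) μ := integrable_loss hL0 hL hp hLg he
  have hnorm : ∀ v : Lp ℝ (ENNReal.ofReal p) μ, ∫ z, |v z| ^ p ∂μ = ‖v‖ ^ p := by
    intro v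
    have h0 : ENNReal.ofReal p ≠ 0 := by simp; linarith
    have h1 : 0 ≤ ∫ z, |v z| ^ p ∂μ := integral_nonneg fun z => by positivity
    have := (Lp.memLp v).eLpNorm_eq_integral_rpow_norm h0 ENNReal.ofReal_ne_top
    rw [ENNReal.toReal_ofReal (by linarith)] at this
    rw [Lp.norm_def, this, ENNReal.toReal_ofReal (by positivity), ← Real.rpow_mul (by simpa using h1),
      inv_mul_cancel₀ (by linarith), Real.rpow_one]
    rfl
  -- An upper bound on the unit ball is two-sided by linearity, so `l` is continuous.
  have hup : ∀ u, ‖u‖ ≤ 1 → l u ≤ γ * (a + b * (‖he.toLp e‖ + 1) ^ p) := by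
    intro u hu
    have h1 : ∫ z, L (e z + u z) ∂μ ≤ a + b * ‖he.toLp e + u‖ ^ p := by
      rw [← hnorm]
      have hi := integrable_abs_rpow hp (Lp.memLp (he.toLp e + u))
      have h2 : a + b * ∫ z, |(he.toLp e + u : Lp ℝ (ENNReal.ofReal p) μ) z| ^ p ∂μ =
          ∫ z, (a + b * |(he.toLp e + u : Lp ℝ (ENNReal.ofReal p) μ) z| ^ p) ∂μ := by
        rw [integral_add (integrable_const _) (hi.const_mul b), integral_const_mul]
        simp
      rw [h2]
      refine integral_mono_ae (hint u) ((integrable_const _).add (hi.const_mul b)) ?_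
      filter_upwards [Lp.coeFn_add (he.toLp e) u, he.coeFn_toLp] with z h3 h4
      rw [h3, Pi.add_apply, h4]
      exact hLg _
    have h2 : 0 ≤ ∫ z, L (e z) ∂μ := integral_nonneg fun z => hL0 _
    have h3 : ‖he.toLp e + u‖ ≤ ‖he.toLp e‖ + 1 := (norm_add_le _ _).trans (by linarith)
    calc l u ≤ γ * ∫ z, L (e z + u z) ∂μ := by nlinarith [hl u]
      _ ≤ γ * (a + b * ‖he.toLp e + u‖ ^ p) := by gcongr
      _ ≤ _ := by gcongr
  let l' : StrongDual ℝ (Lp ℝ (ENNReal.ofReal p) μ) :=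
    l.mkContinuousOfExistsBound ⟨_, LinearMap.bound_of_ball_bound' one_pos _ l fun u hu => by
      have hu' : ‖u‖ ≤ 1 := by simpa using hu
      rw [Real.norm_eq_abs, abs_le]
      have := hup (-u) (by rwa [norm_neg])
      rw [map_neg] at this
      exact ⟨by linarith, hup u hu'⟩⟩
  obtain ⟨c, hcm, hci, hc⟩ := exists_density_of_strongDual_Lp ENNReal.ofReal_ne_top l'
  have hcL : MemLp c (ENNReal.conjExponent (ENNReal.ofReal p)) μ := by
    -- Testing `l` on `t` times the indicator of an arbitrary measurable set localizes the integral
    -- inequality to an almost everywhere one.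
    refine memLp_of_mul_le_loss hp hb ha hγ hL0 hLg he hcm fun t => ?_
    have hit : Integrable (fun z => L (e z + t)) μ :=
      integrable_loss hL0 hL hp hLg (he.add (memLp_const (t : ℝ)))
    refine ae_le_of_forall_setIntegral_le (hci.mul_const _) ((hit.sub hint0).const_mul γ) ?_
    intro s hs _
    have h1 := hl ((t : ℝ) • indicatorConstLp _ hs (measure_ne_top μ s) (1 : ℝ))
    have h2 : l (indicatorConstLp _ hs (measure_ne_top μ s) (1 : ℝ)) = ∫ x in s, c x ∂μ := hc s hs
    rw [map_smul, h2, smul_eq_mul, ← mul_sub, ← integral_sub (hint _) hint0] at h1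
    rw [integral_mul_const, integral_const_mul, mul_comm]
    refine h1.trans_eq ?_
    congr 1
    rw [← integral_indicator hs]
    refine integral_congr_ae ?_
    filter_upwards [Lp.coeFn_smul (t : ℝ) (indicatorConstLp (ENNReal.ofReal p) hs
      (measure_ne_top μ s) (1 : ℝ)), indicatorConstLp_coeFn (p := ENNReal.ofReal p) (hs := hs)
      (hμs := measure_ne_top μ s) (c := (1 : ℝ))] with z h3 h4
    rw [h3, Pi.smul_apply, h4]
    by_cases h : z ∈ s <;> simp [h]
  refine ⟨c, hcm, hcL, fun u => ?_⟩
  have : Fact (1 ≤ ENNReal.conjExponent (ENNReal.ofReal p)) := ⟨by simp [ENNReal.conjExponent]⟩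
  have : ENNReal.HolderConjugate (ENNReal.conjExponent (ENNReal.ofReal p)) (ENNReal.ofReal p) :=
    (ENNReal.HolderConjugate.conjExponent Fact.out).symm
  exact strongDual_Lp_eq_integral ENNReal.ofReal_ne_top l' hcL hc u

theorem convexOn_integral_loss (hL0 : ∀ t, 0 ≤ L t) (hL : ConvexOn ℝ Set.univ L)
    (hp : 1 ≤ p) (hLg : ∀ t, L t ≤ a + b * |t| ^ p)
    {e : Ω → ℝ} (he : MemLp e (ENNReal.ofReal p) μ) :
    ConvexOn ℝ Set.univ
      fun u : Lp ℝ (ENNReal.ofReal p) μ => ∫ z, L (e z + u z) ∂μ := by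
  have hint : ∀ u : Lp ℝ (ENNReal.ofReal p) μ, Integrable (fun z => L (e z + u z)) μ :=
    fun u => integrable_loss hL0 hL hp hLg (he.add (Lp.memLp u))
  refine ⟨convex_univ, fun u _ v _ s t hs ht hst => ?_⟩
  simp only [smul_eq_mul]
  rw [← integral_const_mul, ← integral_const_mul,
    ← integral_add ((hint u).const_mul s) ((hint v).const_mul t)]
  refine integral_mono_ae (hint _) (((hint u).const_mul s).add ((hint v).const_mul t)) ?_
  filter_upwards [Lp.coeFn_add (s • u) (t • v), Lp.coeFn_smul s u, Lp.coeFn_smul t v]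
    with z h1 h2 h3
  rw [h1, Pi.add_apply, h2, h3]
  have h4 := hL.2 (Set.mem_univ (e z + u z)) (Set.mem_univ (e z + v z)) hs ht hst
  have h5 : e z + ((s • ⇑u) z + (t • ⇑v) z) = s • (e z + u z) + t • (e z + v z) := by
    simp only [Pi.smul_apply, smul_eq_mul]
    linear_combination (-e z) * hst
  rw [h5]
  exact h4

end Loss

end SVR

namespace SVR

/-! ### Optimality condition -/

/-- Optimality condition for the primal problem: some `c` in the dual exponent turns
`∫ c Φ` into a subgradient of the regularizer at the solution. -/
theorem IsSolution.exists_subgradient {X : Type*} {Y : Set ℝ} [MeasurableSpace (X × Y)]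
    {P : Measure (X × Y)} [IsProbabilityMeasure P]
    {F : Type*} [NormedAddCommGroup F] [NormedSpace ℝ F]
    {Φ : X → StrongDual ℝ F} (hΦ : StronglyMeasurable fun z : X × Y => Φ z.1)
    {L : ℝ → ℝ} (hL0 : ∀ t, 0 ≤ L t) (hL : ConvexOn ℝ Set.univ L)
    {p : ℝ} (hp : 1 ≤ p) {γ : ℝ} (hγ : 0 < γ) {α β : ℝ} (hα : 0 ≤ α) (hβ : 0 ≤ β)
    (hLg : ∀ t, L t ≤ α + β * |t| ^ p)
    (hΦp : Integrable (fun z : X × Y => ‖Φ z.1‖ ^ p) P)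
    {G : F → ℝ} (hG : ConvexOn ℝ Set.univ G) {w : F} {b : ℝ} {e : X × Y → ℝ}
    (hsol : IsSolution P Φ L p γ G w b e) :
    ∃ c : X × Y → ℝ, Measurable c ∧ MemLp c (ENNReal.conjExponent (ENNReal.ofReal p)) P ∧
      Integrable (fun z => c z • Φ z.1) P ∧
      ∀ v, (∫ z, c z • Φ z.1 ∂P) v ≤ G (w + v) - G w := by
  have hp1 : 1 ≤ ENNReal.ofReal p := by simpa using hp
  have : Fact (1 ≤ ENNReal.ofReal p) := ⟨hp1⟩
  obtain ⟨⟨he, hec⟩, hmin⟩ := hsol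
  have hΦL : MemLp (fun z : X × Y => Φ z.1) (ENNReal.ofReal p) P := by
    rw [← integrable_norm_rpow_iff hΦ.aestronglyMeasurable (by simp; linarith)
      ENNReal.ofReal_ne_top, ENNReal.toReal_ofReal (by linarith)]
    exact hΦp
  have hΦv : ∀ v, MemLp (fun z : X × Y => Φ z.1 v) (ENNReal.ofReal p) P := fun v =>
    (ContinuousLinearMap.apply ℝ ℝ v).comp_memLp' hΦL
  let A : F × ℝ →ₗ[ℝ] Lp ℝ (ENNReal.ofReal p) P :=
    { toFun := fun v => ((hΦv v.1).add (memLp_const v.2)).toLp _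
      map_add' := fun u v => by
        rw [← MemLp.toLp_add]
        congr 1
        ext z
        simp only [Prod.fst_add, Prod.snd_add, Pi.add_apply, map_add]
        ring
      map_smul' := fun k v => by
        rw [RingHom.id_apply, ← MemLp.toLp_const_smul]
        congr 1
        ext z
        simp only [Prod.smul_fst, Prod.smul_snd, Pi.add_apply, Pi.smul_apply, map_smul,
          smul_eq_mul]
        ring }
  have hA : ∀ v, A v =ᵐ[P] fun z => Φ z.1 v.1 + v.2 := fun v =>
    ((hΦv v.1).add (memLp_const v.2)).coeFn_toLp
  let q : Lp ℝ (ENNReal.ofReal p) P × F → ℝ := fun y =>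
    γ * ∫ z, L (e z + y.1 z) ∂P - γ * ∫ z, L (e z) ∂P + (G (w + y.2) - G w)
  have hq : ConvexOn ℝ Set.univ q := by
    have h1 := ((convexOn_integral_loss hL0 hL hp hLg he).smul hγ.le).comp_linearMap
      (LinearMap.fst ℝ _ F)
    have h2 := (hG.translate_right w).comp_linearMap
      (LinearMap.snd ℝ (Lp ℝ (ENNReal.ofReal p) P) F)
    have h3 := (h1.add h2).add_const (-(γ * ∫ z, L (e z) ∂P) - G w)
    refine h3.congr fun y _ => ?_
    simp only [Pi.add_apply, Function.comp_apply, LinearMap.fst_apply, LinearMap.snd_apply,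
      smul_eq_mul, q]
    ring
  -- Moving `(w, b)` by `v` forces the residual to move by `-A v`.
  let T : F × ℝ →ₗ[ℝ] Lp ℝ (ENNReal.ofReal p) P × F := (-A).prod (LinearMap.fst ℝ F ℝ)
  obtain ⟨l, hlq, hlT⟩ := exists_linearMap_le_of_nonneg_on_submodule hq (LinearMap.range T) (by
    rintro _ ⟨v, rfl⟩
    have hae : (fun z => e z + (-A v : Lp ℝ (ENNReal.ofReal p) P) z) =ᵐ[P]
        fun z => e z - (Φ z.1 v.1 + v.2) := by
      filter_upwards [Lp.coeFn_neg (A v), hA v] with z h1 h2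
      rw [h1, Pi.neg_apply, h2, sub_eq_add_neg]
    have hfeas : IsFeasible P Φ p (w + v.1) (b + v.2) fun z => e z - (Φ z.1 v.1 + v.2) := by
      refine ⟨he.sub ((hΦv v.1).add (memLp_const v.2)), ?_⟩
      filter_upwards [hec] with z hz
      rw [← hz, map_add]
      ring
    have h1 := hmin _ _ _ hfeas
    have h2 : ∫ z, L (e z + (-A v : Lp ℝ (ENNReal.ofReal p) P) z) ∂P =
        ∫ z, L (e z - (Φ z.1 v.1 + v.2)) ∂P :=
      integral_congr_ae (hae.fun_comp L)
    change 0 ≤ γ * ∫ z, L (e z + (-A v : Lp ℝ (ENNReal.ofReal p) P) z) ∂P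
      - γ * ∫ z, L (e z) ∂P + (G (w + v.1) - G w)
    simp only [objective] at h1
    rw [h2]
    linarith)
  obtain ⟨c, hcm, hcL, hc⟩ := exists_memLp_of_le_integral_loss hL0 hL hp hα hβ hLg hγ he
    (l.comp (LinearMap.inl ℝ _ F)) fun u => by
      have := hlq (u, 0)
      simp only [q, add_zero, sub_self] at this
      exact this
  have : ENNReal.HolderConjugate (ENNReal.conjExponent (ENNReal.ofReal p)) (ENNReal.ofReal p) :=
    (ENNReal.HolderConjugate.conjExponent hp1).symm
  have hint : Integrable (fun z => c z • Φ z.1) P := by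
    rw [← memLp_one_iff_integrable]
    exact hΦL.smul hcL
  refine ⟨c, hcm, hcL, hint, fun v => ?_⟩
  -- This says `l (A (v, 0), 0) = l (0, v)`: the left side is `(∫ c Φ) v`, the right side is at most
  -- `G (w + v) - G w`.
  have h1 : l (T (v, 0)) = 0 := hlT _ ⟨_, rfl⟩
  have h2 : T (v, 0) = -(A (v, 0), 0) + (0, v) := by simp [T]
  rw [h2, map_add, map_neg] at h1
  have h3 : l (A (v, 0), 0) = ∫ z, c z * (A (v, 0)) z ∂P := hc _
  have h4 : (∫ z, c z • Φ z.1 ∂P) v = ∫ z, c z * (A (v, 0)) z ∂P := by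
    rw [ContinuousLinearMap.integral_apply hint]
    refine integral_congr_ae ?_
    filter_upwards [hA (v, 0)] with z hz
    simp [hz]
  have h5 : l (0, v) ≤ G (w + v) - G w := by
    have h6 := hlq (0, v)
    have h7 : ∫ z, L (e z + (0 : Lp ℝ (ENNReal.ofReal p) P) z) ∂P = ∫ z, L (e z) ∂P := by
      refine integral_congr_ae ?_
      filter_upwards [Lp.coeFn_zero ℝ (ENNReal.ofReal p) P] with z hz
      rw [hz, Pi.zero_apply, add_zero]
    simpa only [q, h7, sub_self, zero_add] using h6
  linarith

end SVR

/-! ### The representer theorem -/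

theorem mainTheorem2
    {X : Type*} {Y : Set ℝ} [MeasurableSpace (X × Y)]
    (P : Measure (X × Y)) [IsProbabilityMeasure P]
    {F : Type*} [NormedAddCommGroup F] [NormedSpace ℝ F] [CompleteSpace F]
    [TopologicalSpace.SeparableSpace F] (hF_refl : SVR.IsReflexiveSpace F)
    [StrictConvexSpace ℝ F] (hF_smooth : SVR.IsSmoothSpace F)
    (Φ : X → StrongDual ℝ F) (hΦ : Measurable fun z : X × Y => Φ z.1)
    (hY : Measurable fun z : X × Y => (z.2 : ℝ))
    (L : ℝ → ℝ) (hL_nonneg : ∀ t, 0 ≤ L t) (hL_conv : ConvexOn ℝ Set.univ L)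
    (p : ℝ) (hp : 1 ≤ p) (γ : ℝ) (hγ : 0 < γ)
    (hL_growth : ∃ a b : ℝ, 0 ≤ a ∧ 0 ≤ b ∧ ∀ t, L t ≤ a + b * |t| ^ p)
    (hY_moment : Integrable (fun z : X × Y => |(z.2 : ℝ)| ^ p) P)
    (hΦ_moment : Integrable (fun z : X × Y => ‖Φ z.1‖ ^ p) P)
    (φ : ℝ → ℝ) (hφ_nonneg : ∀ t, 0 ≤ φ t) (hφ_conv : ConvexOn ℝ Set.univ φ)
    (hφ_even : ∀ t, φ (-t) = φ t) (hφ_argmin : {t : ℝ | ∀ s, φ t ≤ φ s} = {0})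
    (w : F) (b : ℝ) (e : X × Y → ℝ)
    (hsol : SVR.IsSolution P Φ L p γ (fun v => φ ‖v‖) w b e) :
    (∀ r : ℝ, 1 < r →
      ∃ c : X × Y → ℝ, Measurable c ∧
        MemLp c (ENNReal.conjExponent (ENNReal.ofReal p)) P ∧
        Integrable (fun z => c z • Φ z.1) P ∧
        SVR.dualityMap r w = ∫ z, c z • Φ z.1 ∂P) ∧
    (∀ (n : ℕ) (s : Fin n → X × Y),
      P = (n : ℝ≥0∞)⁻¹ • ∑ i, Measure.dirac (s i) →
      ∃ c : Fin n → ℝ, SVR.dualityMap 2 w = ∑ i, c i • Φ (s i).1) := by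
  have := hF_refl.separableSpace_strongDual
  have hΦs : StronglyMeasurable fun z : X × Y => Φ z.1 := hΦ.stronglyMeasurable
  obtain ⟨α, β, hα, hβ, hLg⟩ := hL_growth
  obtain ⟨c, hcm, hcL, hci, hsub⟩ := hsol.exists_subgradient hΦs hL_nonneg hL_conv hp hγ hα hβ hLg
    hΦ_moment (SVR.convexOn_even_comp_norm hφ_conv hφ_even)
  have hrep : ∀ r : ℝ, 1 < r →
      ∃ c : X × Y → ℝ, Measurable c ∧
        MemLp c (ENNReal.conjExponent (ENNReal.ofReal p)) P ∧
        Integrable (fun z => c z • Φ z.1) P ∧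
        SVR.dualityMap r w = ∫ z, c z • Φ z.1 ∂P := by
    intro r hr
    obtain ⟨k, hk⟩ := SVR.exists_dualityMap_eq_smul hF_smooth hφ_conv hφ_even hφ_argmin hsub hr
    refine ⟨fun z => k * c z, hcm.const_mul k, hcL.const_mul k, ?_, ?_⟩
    · simpa only [mul_smul] using! hci.smul k
    · rw [hk, ← integral_smul]
      simp only [mul_smul]
  refine ⟨hrep, fun n s hP => ?_⟩
  obtain ⟨c, hcm, -, hci, hc⟩ := hrep 2 one_lt_two
  refine ⟨fun i => (n : ℝ)⁻¹ * c (s i), ?_⟩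
  -- Singletons need not be measurable, so evaluating Dirac integrals uses strong measurability of
  -- the integrand itself, not of an almost everywhere representative.
  have hf : StronglyMeasurable fun z => c z • Φ z.1 := hcm.stronglyMeasurable.smul hΦs
  rw [hc, hP, integral_smul_measure, integral_finsetSum_measure, Finset.smul_sum]
  · refine Finset.sum_congr rfl fun i _ => ?_
    rw [integral_dirac' _ _ hf, mul_smul]
    simp
  · intro i _
    exact integrable_dirac' hf (by simp)
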